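/- Let $(\alpha_n)_{n\ge 0}$ be the sequence of pseudo-factorials, i.e. the integers determined by \[ \alpha_0=1,\qquad \alpha_{n+1}=(-1)^{n+1}\sum_{k=0}^{n}\binom nk\,\alpha_k\,\alpha_{n-k}\quad(n\ge 0), \] and put $a_j=-j^2\,(2-(-1)^j)$ for $j\ge 1$. Then for every positive integer $m$ the Hankel determinant $H_m^{(0)}=\det(\alpha_{i+j})_{0\le i,j<m}$ satisfies \[ H_m^{(0)}=\prod_{j=1}^{m-1}a_j^{\,m-j} =(-1)^{\lfloor m/2\rfloor}\,3^{\lfloor m^2/4\rfloor}\Bigl(\prod_{k=1}^{m-1}k!\Bigr)^2 . \] -/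

import Mathlib

/-- The pseudo-factorials: `α 0 = 1` and
`α (n+1) = (-1)^(n+1) * ∑_{k=0}^{n} (n choose k) * α k * α (n-k)`.
The sum is indexed by `Fin (n+1)` so that the recursive calls are visibly decreasing. -/
def pseudoFactorial : ℕ → ℤ
  | 0 => 1
  | n + 1 => (-1) ^ (n + 1) *
      ∑ k : Fin (n + 1),
        (n.choose (k : ℕ) : ℤ) * pseudoFactorial (k : ℕ) * pseudoFactorial (n - (k : ℕ))
termination_by n => n
decreasing_by
  · exact k.isLt
  · omega

theorem pseudoFactorial_zero : pseudoFactorial 0 = 1 := by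
  rw [pseudoFactorial]

theorem pseudoFactorial_succ (n : ℕ) :
    pseudoFactorial (n + 1) = (-1) ^ (n + 1) *
      ∑ k ∈ Finset.range (n + 1),
        (n.choose k : ℤ) * pseudoFactorial k * pseudoFactorial (n - k) := by
  rw [pseudoFactorial, Finset.sum_range]

/-- The coefficients `a_j = -j² (2 - (-1)^j)`: `-3·1², -2², -3·3², -4², …` for `j = 1, 2, 3, 4, …`. -/
def fractionNumerator (j : ℕ) : ℤ := -(j : ℤ) ^ 2 * (2 - (-1) ^ j)

/-- The `m × m` Hankel matrix `(α_{i+j})_{0 ≤ i, j < m}` of the pseudo-factorials. -/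
def pseudoFactorialHankel (m : ℕ) : Matrix (Fin m) (Fin m) ℤ :=
  Matrix.of fun i j => pseudoFactorial ((i : ℕ) + (j : ℕ))

/-! The alternating sign in the recurrence becomes X → -X, so F and G(X) = F(-X) satisfy F' = -G²,
G' = F², whence F³ + G³ = 2. Modulo this cubic, differentiation acts tridiagonally on F uʳ, (G² - F)
uʳ with u = 1 - FG. Only the first of these series is nonzero at 0, so their Taylor coefficients,
rescaled, form a unitriangular Stieltjes matrix L whose column 0 is α. The tridiagonal operator is
symmetric for the weights a₁⋯a_k (`sum_stieltjesEntry_shift`), which gives the factorization L D Lᵀ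
of the Hankel matrix, with D the diagonal of these weights. -/

/-! ### The differential system -/

/-- The exponential generating function of the pseudo-factorials. -/
noncomputable def pseudoFactorialEGF : PowerSeries ℚ :=
  PowerSeries.mk fun n => (pseudoFactorial n : ℚ) / n.factorial

/-- The exponential generating function at `-X`. -/
noncomputable def pseudoFactorialEGFNeg : PowerSeries ℚ :=
  PowerSeries.mk fun n => (-1) ^ n * (pseudoFactorial n : ℚ) / n.factorial

local notation "F" => pseudoFactorialEGF
local notation "G" => pseudoFactorialEGFNeg
local notation "∂" => PowerSeries.derivative ℚ

theorem sum_antidiagonal_egf (n : ℕ) :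
    ∑ p ∈ Finset.HasAntidiagonal.antidiagonal n, ((pseudoFactorial p.1 : ℚ) / p.1.factorial) *
        ((pseudoFactorial p.2 : ℚ) / p.2.factorial) =
      (-1) ^ (n + 1) * (pseudoFactorial (n + 1) : ℚ) / n.factorial := by
  rw [Finset.Nat.sum_antidiagonal_eq_sum_range_succ
    (fun i j => ((pseudoFactorial i : ℚ) / i.factorial) * ((pseudoFactorial j : ℚ) / j.factorial)),
    pseudoFactorial_succ]
  push_cast
  rw [← mul_assoc, ← mul_pow]
  norm_num
  rw [Finset.sum_div]
  refine Finset.sum_congr rfl fun k hk => ?_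
  have hk' : k ≤ n := by simpa [Nat.lt_succ_iff] using hk
  rw [Nat.cast_choose ℚ hk']
  have := Nat.factorial_ne_zero n
  field_simp

theorem coeff_egf_sq (n : ℕ) : PowerSeries.coeff n (F ^ 2) =
    (-1) ^ (n + 1) * (pseudoFactorial (n + 1) : ℚ) / n.factorial := by
  rw [sq, PowerSeries.coeff_mul, ← sum_antidiagonal_egf]
  simp [pseudoFactorialEGF]

theorem coeff_egfNeg_sq (n : ℕ) : PowerSeries.coeff n (G ^ 2) =
    -(pseudoFactorial (n + 1) : ℚ) / n.factorial := by
  have h : PowerSeries.coeff n (G ^ 2) = (-1) ^ n * PowerSeries.coeff n (F ^ 2) := by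
    rw [sq, sq, PowerSeries.coeff_mul, PowerSeries.coeff_mul, Finset.mul_sum]
    refine Finset.sum_congr rfl fun p hp => ?_
    rw [← Finset.HasAntidiagonal.mem_antidiagonal.mp hp, pow_add]
    simp only [pseudoFactorialEGF, pseudoFactorialEGFNeg, PowerSeries.coeff_mk]
    ring
  rw [h, coeff_egf_sq, mul_div_assoc, ← mul_assoc, ← pow_add,
    show n + (n + 1) = 2 * n + 1 by ring, pow_succ, pow_mul]
  norm_num [neg_div]

theorem derivative_egf : ∂ F = -G ^ 2 := by
  ext n
  rw [PowerSeries.coeff_derivative, map_neg, coeff_egfNeg_sq,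
    pseudoFactorialEGF, PowerSeries.coeff_mk, Nat.factorial_succ]
  have := Nat.factorial_ne_zero n
  push_cast
  field_simp

theorem derivative_egfNeg : ∂ G = F ^ 2 := by
  ext n
  rw [PowerSeries.coeff_derivative, coeff_egf_sq,
    pseudoFactorialEGFNeg, PowerSeries.coeff_mk, Nat.factorial_succ]
  have := Nat.factorial_ne_zero n
  push_cast
  field_simp

theorem constantCoeff_egf : PowerSeries.constantCoeff F = 1 := by
  rw [← PowerSeries.coeff_zero_eq_constantCoeff_apply]
  simp [pseudoFactorialEGF, pseudoFactorial_zero]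

theorem constantCoeff_egfNeg : PowerSeries.constantCoeff G = 1 := by
  rw [← PowerSeries.coeff_zero_eq_constantCoeff_apply]
  simp [pseudoFactorialEGFNeg, pseudoFactorial_zero]

/-- The generating function parametrizes the Fermat cubic. -/
theorem egf_cube_add_egfNeg_cube : F ^ 3 + G ^ 3 = 2 := by
  apply PowerSeries.derivative.ext
  · have h2 : ∂ (2 : PowerSeries ℚ) = 0 := by
      simpa using (PowerSeries.derivative ℚ).map_natCast 2
    rw [h2, map_add, Derivation.leibniz_pow, Derivation.leibniz_pow, derivative_egf,
      derivative_egfNeg]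
    simp only [smul_eq_mul, nsmul_eq_mul]
    push_cast
    ring
  · simp only [map_add, map_pow, constantCoeff_egf, constantCoeff_egfNeg, map_ofNat]
    norm_num

/-! ### Tridiagonal action of the derivative -/

theorem derivative_one_sub_mul : ∂ (1 - F * G) = G ^ 3 - F ^ 3 := by
  rw [map_sub, Derivation.leibniz, derivative_egf, derivative_egfNeg]
  simp only [smul_eq_mul, Derivation.map_one_eq_zero]
  ring

theorem derivative_one_sub_mul_pow (k : ℕ) :
    ∂ ((1 - F * G) ^ k) = k * (1 - F * G) ^ (k - 1) * (G ^ 3 - F ^ 3) := by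
  rw [Derivation.leibniz_pow, derivative_one_sub_mul]
  simp only [smul_eq_mul, nsmul_eq_mul]
  ring

theorem derivative_egf_mul_pow (k : ℕ) :
    ∂ (F * (1 - F * G) ^ (k + 1)) =
      (2 * k + 2) * ((G ^ 2 - F) * (1 - F * G) ^ k)
        - (2 * k + 3) * (F * (1 - F * G) ^ (k + 1))
        - (2 * k + 3) * ((G ^ 2 - F) * (1 - F * G) ^ (k + 1)) := by
  rw [Derivation.leibniz, derivative_one_sub_mul_pow, derivative_egf]
  simp only [smul_eq_mul, Nat.add_sub_cancel]
  push_cast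
  -- The two sides differ by a multiple of F⁴ + F G³ - 2F, which the cubic kills.
  linear_combination (-(k + 1) * F * (1 - F * G) ^ k) * egf_cube_add_egfNeg_cube

theorem derivative_sq_sub_mul_pow (k : ℕ) :
    ∂ ((G ^ 2 - F) * (1 - F * G) ^ k) =
      3 * (2 * k + 1) * (F * (1 - F * G) ^ k)
        + (2 * k + 1) * ((G ^ 2 - F) * (1 - F * G) ^ k)
        - (2 * k + 2) * (F * (1 - F * G) ^ (k + 1)) := by
  have h := egf_cube_add_egfNeg_cube
  rw [Derivation.leibniz, derivative_one_sub_mul_pow, map_sub, Derivation.leibniz_pow,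
    derivative_egf, derivative_egfNeg]
  simp only [smul_eq_mul, nsmul_eq_mul]
  -- The exponent k - 1 truncates at k = 0, where the cubic is not needed.
  rcases k with _ | k
  · push_cast
    ring
  · simp only [Nat.add_sub_cancel]
    push_cast
    linear_combination ((k + 1) * (G ^ 2 + F) * (1 - F * G) ^ k) * h

/-! ### The Stieltjes matrix -/

/-- The linear coefficients of the continued fraction. -/
def fractionLinear (k : ℕ) : ℤ := (-1) ^ (k + 1) * (2 * ((k / 2 : ℕ) : ℤ) + 1)

/-- The Stieltjes matrix of the continued fraction. -/
def stieltjesEntry : ℕ → ℕ → ℤ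
  | 0, 0 => 1
  | 0, _ + 1 => 0
  | n + 1, 0 => fractionLinear 0 * stieltjesEntry n 0 + fractionNumerator 1 * stieltjesEntry n 1
  | n + 1, k + 1 => stieltjesEntry n k + fractionLinear (k + 1) * stieltjesEntry n (k + 1) +
      fractionNumerator (k + 2) * stieltjesEntry n (k + 2)

theorem stieltjesEntry_of_lt {n k : ℕ} (h : n < k) : stieltjesEntry n k = 0 := by
  induction n generalizing k with
  | zero => obtain ⟨k, rfl⟩ := Nat.exists_eq_succ_of_ne_zero h.ne'; simp [stieltjesEntry]
  | succ n ih =>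
    obtain ⟨k, rfl⟩ := Nat.exists_eq_succ_of_ne_zero (Nat.ne_zero_of_lt h)
    simp [stieltjesEntry, ih (show n < k by omega), ih (show n < k + 1 by omega),
      ih (show n < k + 2 by omega)]

theorem stieltjesEntry_self (n : ℕ) : stieltjesEntry n n = 1 := by
  induction n with
  | zero => simp [stieltjesEntry]
  | succ n ih =>
    simp [stieltjesEntry, ih, stieltjesEntry_of_lt (show n < n + 1 by omega),
      stieltjesEntry_of_lt (show n < n + 2 by omega)]

/-- The orthogonal system `F u ^ k`, `(G² - F) u ^ k` with `u = 1 - F G`. -/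
noncomputable def orthogonalSeries (k : ℕ) : PowerSeries ℚ :=
  (if Even k then F else G ^ 2 - F) * (1 - F * G) ^ (k / 2)

/-- The factor `k! ∏_{j ≤ k} (2 - (-1)^j)`, the leading coefficient of `orthogonalSeries k`
in the basis `X ^ k / k!`. -/
def orthogonalScale (k : ℕ) : ℚ := ∏ j ∈ Finset.range k, (j + 1 : ℚ) * (2 - (-1) ^ (j + 1))

theorem orthogonalScale_succ (k : ℕ) :
    orthogonalScale (k + 1) = orthogonalScale k * ((k + 1 : ℚ) * (2 - (-1) ^ (k + 1))) :=
  Finset.prod_range_succ _ _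

theorem derivative_orthogonalSeries_zero :
    ∂ (orthogonalSeries 0) = -orthogonalSeries 0 - orthogonalSeries 1 := by
  simp [orthogonalSeries, derivative_egf]
  ring

theorem derivative_orthogonalSeries_succ (k : ℕ) :
    ∂ (orthogonalSeries (k + 1)) =
      ((k + 1 : ℚ) * (2 - (-1) ^ (k + 1))) • orthogonalSeries k
        + (fractionLinear (k + 1) : ℚ) • orthogonalSeries (k + 1)
        - (k + 2 : ℚ) • orthogonalSeries (k + 2) := by
  rcases Nat.even_or_odd' k with ⟨r, rfl | rfl⟩
  · have h1 : (2 * r + 1) / 2 = r := by omega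
    have h2 : (2 * r + 2) / 2 = r + 1 := by omega
    have h3 : ¬ Even (2 * r + 1) := by simp
    have h4 : Even (2 * r + 2) := ⟨r + 1, by ring⟩
    have e : (-1 : ℚ) ^ (2 * r + 1) = -1 := Odd.neg_one_pow ⟨r, rfl⟩
    have e' : (-1 : ℚ) ^ (2 * r + 1 + 1) = 1 := Even.neg_one_pow h4
    simp only [orthogonalSeries, fractionLinear, h1, h2, h3, h4, even_two_mul, if_true, if_false,
      Nat.mul_div_cancel_left r two_pos, derivative_sq_sub_mul_pow]
    push_cast
    rw [e, e']
    simp only [PowerSeries.smul_eq_C_mul, map_mul, map_add, map_sub, map_neg, map_one, map_natCast,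
      map_ofNat]
    ring
  · have h1 : (2 * r + 1) / 2 = r := by omega
    have h2 : (2 * r + 1 + 1) / 2 = r + 1 := by omega
    have h2' : (2 * r + 1 + 2) / 2 = r + 1 := by omega
    have h3 : ¬ Even (2 * r + 1) := by simp
    have h4 : Even (2 * r + 1 + 1) := ⟨r + 1, by ring⟩
    have h5 : ¬ Even (2 * r + 1 + 2) := by rw [Nat.even_iff]; omega
    have e : (-1 : ℚ) ^ (2 * r + 1 + 1) = 1 := Even.neg_one_pow h4
    have e' : (-1 : ℚ) ^ (2 * r + 1 + 1 + 1) = -1 := by rw [pow_succ, e]; norm_num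
    simp only [orthogonalSeries, fractionLinear, h1, h2, h2', h3, h4, h5, if_true, if_false,
      derivative_egf_mul_pow]
    push_cast
    rw [e, e']
    simp only [PowerSeries.smul_eq_C_mul, map_mul, map_add, map_sub, map_neg, map_one, map_natCast,
      map_ofNat]
    ring

theorem constantCoeff_orthogonalSeries_succ (k : ℕ) :
    PowerSeries.constantCoeff (orthogonalSeries (k + 1)) = 0 := by
  rcases k with _ | k
  · simp [orthogonalSeries, constantCoeff_egf, constantCoeff_egfNeg]
  · have : (k + 1 + 1) / 2 ≠ 0 := by omega
    rw [orthogonalSeries, map_mul, map_pow, map_sub, map_mul, constantCoeff_egf,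
      constantCoeff_egfNeg]
    simp [this]

/-- Both sides obey the same recurrence in n: the scale turns the lowering coefficient into 1, and
the raising coefficient -(k + 1) into a_{k+1}. -/
theorem constantCoeff_iterate_derivative_orthogonalSeries (n k : ℕ) :
    PowerSeries.constantCoeff (∂^[n] (orthogonalSeries k)) =
      orthogonalScale k * stieltjesEntry n k := by
  induction n generalizing k with
  | zero =>
    rcases k with _ | k
    · simp [orthogonalSeries, constantCoeff_egf, orthogonalScale, stieltjesEntry]
    · simp [constantCoeff_orthogonalSeries_succ, stieltjesEntry]
  | succ n ih =>
    -- As a power of a linear map, the iterate distributes over the three-term relation.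
    have hit (p : PowerSeries ℚ) : ∂^[n] p = ((∂ : PowerSeries ℚ →ₗ[ℚ] PowerSeries ℚ) ^ n) p := by
      rw [Module.End.pow_apply]; rfl
    rw [Function.iterate_succ_apply]
    simp only [hit] at ih ⊢
    rcases k with _ | k
    · rw [derivative_orthogonalSeries_zero, map_sub, map_neg, map_sub, map_neg, ih, ih]
      simp [stieltjesEntry, orthogonalScale, fractionLinear, fractionNumerator]
      ring
    · rw [derivative_orthogonalSeries_succ, map_sub, map_add, map_smul, map_smul, map_smul,
        map_sub, map_add, PowerSeries.constantCoeff_smul, PowerSeries.constantCoeff_smul,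
        PowerSeries.constantCoeff_smul, ih, ih, ih, orthogonalScale_succ (k + 1),
        orthogonalScale_succ k]
      simp only [stieltjesEntry, fractionNumerator, smul_eq_mul]
      push_cast
      ring

theorem stieltjesEntry_zero_right (n : ℕ) : stieltjesEntry n 0 = pseudoFactorial n := by
  have h := constantCoeff_iterate_derivative_orthogonalSeries n 0
  have h' : orthogonalSeries 0 = F := by simp [orthogonalSeries]
  rw [h'] at h
  have hn : (PowerSeries.constantCoeff (∂^[n] F) : ℚ) = pseudoFactorial n := by
    rw [← PowerSeries.coeff_zero_eq_constantCoeff_apply, PowerSeries.coeff_iterate_derivative]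
    have := Nat.factorial_ne_zero n
    simp [pseudoFactorialEGF]
    field_simp
  rw [hn] at h
  simp only [orthogonalScale, Finset.range_zero, Finset.prod_empty, one_mul] at h
  exact_mod_cast h.symm

/-! ### Factorization of the Hankel matrix -/

/-- The squared norms `a_1 ⋯ a_k`. -/
def fractionNorm (k : ℕ) : ℤ := ∏ j ∈ Finset.range k, fractionNumerator (j + 1)

theorem fractionNorm_succ (k : ℕ) :
    fractionNorm (k + 1) = fractionNorm k * fractionNumerator (k + 1) :=
  Finset.prod_range_succ _ _

/-- Christoffel–Darboux telescoping: the diagonal terms cancel, and the off-diagonal ones cancel in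
pairs up to the boundary. -/
theorem sum_stieltjesEntry_shift (i j N : ℕ) :
    ∑ k ∈ Finset.range (N + 1), (stieltjesEntry (i + 1) k * fractionNorm k * stieltjesEntry j k -
        stieltjesEntry i k * fractionNorm k * stieltjesEntry (j + 1) k) =
      fractionNorm (N + 1) * (stieltjesEntry i (N + 1) * stieltjesEntry j N -
        stieltjesEntry i N * stieltjesEntry j (N + 1)) := by
  induction N with
  | zero =>
    simp [stieltjesEntry, fractionNorm]
    ring
  | succ N ih =>
    rw [Finset.sum_range_succ, ih, fractionNorm_succ (N + 1)]
    simp only [stieltjesEntry]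
    ring

theorem sum_stieltjesEntry_mul (i j N : ℕ) (h : i < N) :
    ∑ k ∈ Finset.range N, stieltjesEntry i k * fractionNorm k * stieltjesEntry j k =
      pseudoFactorial (i + j) := by
  obtain ⟨N, rfl⟩ := Nat.exists_eq_succ_of_ne_zero (Nat.ne_zero_of_lt h)
  induction i generalizing j with
  | zero =>
    rw [Finset.sum_range_succ']
    simp [stieltjesEntry, fractionNorm, stieltjesEntry_zero_right]
  | succ i ih =>
    have hs := sum_stieltjesEntry_shift i j N
    -- Row i vanishes past its diagonal, so there is no boundary term and one unit moves from i to
    -- j.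
    rw [stieltjesEntry_of_lt (show i < N + 1 by omega), stieltjesEntry_of_lt (show i < N by omega),
      Finset.sum_sub_distrib] at hs
    have hi := ih (j + 1) (by omega)
    rw [show i + 1 + j = i + (j + 1) by ring, ← hi]
    linarith

theorem det_pseudoFactorialHankel (m : ℕ) :
    (pseudoFactorialHankel m).det = ∏ k ∈ Finset.range m, fractionNorm k := by
  let L : Matrix (Fin m) (Fin m) ℤ := Matrix.of fun i k => stieltjesEntry i k
  have hL : L.det = 1 := by
    rw [Matrix.det_of_isLowerTriangular L fun i k hik => stieltjesEntry_of_lt hik]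
    exact Finset.prod_eq_one fun i _ => stieltjesEntry_self i
  have hH : pseudoFactorialHankel m =
      L * Matrix.diagonal (fun k : Fin m => fractionNorm k) * L.transpose := by
    ext i j
    rw [Matrix.mul_apply, pseudoFactorialHankel, Matrix.of_apply,
      ← sum_stieltjesEntry_mul i j m i.isLt, Finset.sum_range]
    simp [L, Matrix.mul_diagonal]
  rw [hH, Matrix.det_mul, Matrix.det_mul, Matrix.det_transpose, hL, Matrix.det_diagonal,
    Finset.prod_range]
  simp

/-! ### Closed forms of the product -/

theorem prod_fractionNorm_eq_prod_pow (m : ℕ) :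
    ∏ k ∈ Finset.range (m + 1), fractionNorm k =
      ∏ j ∈ Finset.range m, fractionNumerator (j + 1) ^ (m - j) := by
  induction m with
  | zero => simp [fractionNorm]
  | succ m ih =>
    rw [Finset.prod_range_succ, ih, fractionNorm, Finset.prod_range_succ, Finset.prod_range_succ,
      ← mul_assoc, ← Finset.prod_mul_distrib, Nat.sub_eq_of_eq_add (Nat.add_comm m 1), pow_one]
    congr 1
    refine Finset.prod_congr rfl fun j hj => ?_
    rw [← pow_succ, Nat.succ_sub (Finset.mem_range.mp hj).le]

/-- Each odd j ≤ k contributes one factor 3, and there are ⌊(k + 1)/2⌋ of them. -/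
theorem fractionNorm_eq (k : ℕ) :
    fractionNorm k = (-1) ^ k * 3 ^ ((k + 1) / 2) * (k.factorial : ℤ) ^ 2 := by
  induction k with
  | zero => simp [fractionNorm]
  | succ k ih =>
    rw [fractionNorm_succ, ih, fractionNumerator, Nat.factorial_succ]
    rcases Nat.even_or_odd' k with ⟨r, rfl | rfl⟩
    · rw [show (2 * r + 1) / 2 = r by omega, show (2 * r + 1 + 1) / 2 = r + 1 by omega]
      simp only [pow_succ, pow_mul]
      push_cast
      norm_num
      ring
    · rw [show (2 * r + 1 + 1) / 2 = r + 1 by omega, show (2 * r + 1 + 1 + 1) / 2 = r + 1 by omega]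
      simp only [pow_succ, pow_mul]
      push_cast
      norm_num
      ring

theorem prod_fractionNorm_eq (m : ℕ) :
    ∏ k ∈ Finset.range (m + 1), fractionNorm k =
      (-1) ^ ((m + 1) / 2) * 3 ^ ((m + 1) ^ 2 / 4) *
        (∏ k ∈ Finset.range m, ((k + 1).factorial : ℤ)) ^ 2 := by
  induction m with
  | zero => simp [fractionNorm]
  | succ m ih =>
    rw [Finset.prod_range_succ, ih, fractionNorm_eq, Finset.prod_range_succ _ m]
    have h3 : (m + 1 + 1) ^ 2 / 4 = (m + 1) ^ 2 / 4 + (m + 1 + 1) / 2 := by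
      rcases Nat.even_or_odd' m with ⟨r, rfl | rfl⟩
      · rw [show (2 * r + 1 + 1) ^ 2 = 4 * (r ^ 2 + 2 * r + 1) by ring,
          show (2 * r + 1) ^ 2 = 4 * (r ^ 2 + r) + 1 by ring]
        omega
      · rw [show (2 * r + 1 + 1 + 1) ^ 2 = 4 * (r ^ 2 + 3 * r + 2) + 1 by ring,
          show (2 * r + 1 + 1) ^ 2 = 4 * (r ^ 2 + 2 * r + 1) by ring]
        omega
    have h1 : (-1 : ℤ) ^ ((m + 1 + 1) / 2) = (-1) ^ ((m + 1) / 2) * (-1) ^ (m + 1) := by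
      rw [← pow_add, neg_one_pow_eq_pow_mod_two, neg_one_pow_eq_pow_mod_two (n := _ + _)]
      congr 1
      rcases Nat.even_or_odd' m with ⟨r, rfl | rfl⟩
      · rw [show (2 * r + 1 + 1) / 2 = r + 1 by omega, show (2 * r + 1) / 2 = r by omega]
        omega
      · rw [show (2 * r + 1 + 1 + 1) / 2 = r + 1 by omega,
          show (2 * r + 1 + 1) / 2 = r + 1 by omega]
        omega
    rw [h3, h1, pow_add]
    ring

theorem prod_Icc_one_eq_prod_range {M : Type*} [CommMonoid M] (f : ℕ → M) (n : ℕ) :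
    ∏ j ∈ Finset.Icc 1 n, f j = ∏ j ∈ Finset.range n, f (j + 1) := by
  rw [Finset.range_eq_Ico, Finset.prod_Ico_add' f 0 n 1]
  rfl

theorem mainTheorem7 (m : ℕ) (hm : 0 < m) :
    (pseudoFactorialHankel m).det =
        ∏ j ∈ Finset.Icc 1 (m - 1), fractionNumerator j ^ (m - j) ∧
      (pseudoFactorialHankel m).det =
        (-1) ^ (m / 2) * 3 ^ (m ^ 2 / 4) *
          (∏ k ∈ Finset.Icc 1 (m - 1), (Nat.factorial k : ℤ)) ^ 2 := by
  obtain ⟨m, rfl⟩ := Nat.exists_eq_succ_of_ne_zero hm.ne'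
  simp only [Nat.succ_eq_add_one, Nat.add_sub_cancel, prod_Icc_one_eq_prod_range,
    det_pseudoFactorialHankel]
  refine ⟨?_, prod_fractionNorm_eq m⟩
  rw [prod_fractionNorm_eq_prod_pow]
  exact Finset.prod_congr rfl fun j _ => by rw [Nat.add_sub_add_right]
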